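/- Let $p \ge 5$ be a prime, let $G$ be a finite $p$-group, and let $V$ be a finite elementary abelian $p$-group on which $G$ acts by automorphisms. A subgroup $E \le G$ is called an \emph{offender} on $V$ if $E$ is a nontrivial elementary abelian $p$-group and $|E|\,|C_V(E)| \ge |V|$, where $C_V(E)$ is the subgroup of elements of $V$ fixed by $E$. It is called \emph{quadratic} if $[V,E,E]=1$ and $[V,E]\ne 1$, where for $W \le V$, $[W,E]$ denotes the subgroup of $V$ generated by the elements $(e\cdot w)\,w^{-1}$ with $e\in E$, $w\in W$, and $[V,E,E]=[[V,E],E]$. Suppose that $V$ is an \emph{F-module} for $G$, that is, the action of $G$ on $V$ is faithful and there is an offender on $V$ in $G$. Then there exists a quadratic offender $E \le G$ on $V$ which is normal in its normal closure $\langle E^G\rangle$ in $G$ (that is, $E$ is $2$-subnormal in $G$). -/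

import Mathlib

/-- A group `H` is an elementary abelian `p`-group: it is abelian and every element `x`
satisfies `x ^ p = 1`. -/
def IsElementaryAbelianP (p : ℕ) (H : Type*) [Group H] : Prop :=
  (∀ x y : H, x * y = y * x) ∧ ∀ x : H, x ^ p = 1

section Action

variable {G V : Type*} [Group G] [CommGroup V] [MulDistribMulAction G V]

/-- The commutator subgroup `[W, E] ≤ V`, for `W ≤ V` and `E ≤ G`: the subgroup generated by the
commutators `[e, w] = (e • w) * w⁻¹` of the semidirect product `V ⋊ G`, for `e ∈ E`, `w ∈ W`. -/
def actionCommutator (W : Subgroup V) (E : Subgroup G) : Subgroup V :=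
  Subgroup.closure {x : V | ∃ e ∈ E, ∃ w ∈ W, x = (e • w) * w⁻¹}

variable (V) in
/-- `E ≤ G` is an offender on `V`: a nontrivial elementary abelian `p`-subgroup of `G` such that
`|E| |C_V(E)| ≥ |V|`. -/
def IsOffender (p : ℕ) (E : Subgroup G) : Prop :=
  E ≠ ⊥ ∧ IsElementaryAbelianP p E ∧
    Nat.card V ≤ Nat.card E * Nat.card (FixedPoints.subgroup E V)

variable (V) in
/-- `E ≤ G` acts quadratically on `V`: `[V, E, E] = 1`, but `E` does not centralize `V`. -/
def ActsQuadratically (E : Subgroup G) : Prop :=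
  actionCommutator (actionCommutator (⊤ : Subgroup V) E) E = ⊥ ∧
    actionCommutator (⊤ : Subgroup V) E ≠ ⊥

variable (G V) in
/-- `V` is an F-module for `G`: the action of `G` on `V` is faithful, and some subgroup of `G` is
an offender on `V`. -/
def IsFModule (p : ℕ) : Prop :=
  FaithfulSMul G V ∧ ∃ E : Subgroup G, IsOffender V p E

end Action

/-! Write `ρ` for the linear representation on `V` over `ZMod p`. A subgroup `E` is quadratic when
any two elements of `ρ(E) - 1` have product zero; then `e ↦ ρ e - 1` is a logarithm that turns `E`
into an additive group of the same order. Thompson's counting argument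
(`smul_commutator_eq_of_minimal`) shows that an offender of least order is quadratic, so quadratic
offenders exist. Among them choose `E` with the sum of the orders of its intersections with the
terms of the lower central series as large as possible.

The main point is a replacement (`exists_replacement`). Let `b` be a conjugate of an element of `E`,
so that `β = ρ b - 1` has square zero, and suppose that the conjugates of `E` under powers of `b`
normalize each other. Let `T` be the limit of the conjugates of `ρ(E) - 1` by `1 + tβ` as `t` tends
to infinity, taken algebraically with `t = 1/X`. Passing to the limit keeps products zero and lowers
neither the order of the group nor that of its common kernel. Since 2 is invertible, a
Baker-Campbell-Hausdorff identity shows that every element of `T` is `ρ g - 1` for some `g` in `G`,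
so `T` is the logarithm of a quadratic offender `F`. If `b` does not normalize `E`, some
intersection of `F` with the lower central series is strictly larger than that of `E`, against the
choice of `E`. Hence `b` normalizes `E`.

It remains to remove the assumption on powers of `b`. By induction on `H ≥ E`, all `H`-conjugates of
elements of `E` normalize `E`: these conjugates lie in a proper normal subgroup `K` of `H`
containing `E`, and induction in `K` supplies the assumption. The case `H = G` is the theorem. -/

open Polynomial
open scoped commutatorElement

/-! ### A Baker-Campbell-Hausdorff identity for square-zero elements. -/

section Ring

variable {R : Type*} [Ring R]

/-- The product identity behind the exponential map for three square-zero elements whose sum also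
has square zero. -/
theorem one_add_mul_one_add_mul_one_add_of_sq_zero
    (h2 : ∀ y : R, y + y = 0 → y = 0) {u v w f g k : R}
    (huu : u * u = 0) (hvv : v * v = 0) (hww : w * w = 0)
    (hf : u * v - v * u = f + f) (hg : u * w - w * u = g + g) (hk : v * w - w * v = k + k)
    (uf : u * f = 0) (vf : v * f = 0) (fv : f * v = 0)
    (ug : u * g = 0) (wg : w * g = 0) (gw : g * w = 0)
    (vk : v * k = 0) (kv : k * v = 0) (wk : w * k = 0) (kw : k * w = 0)
    (ff : f * f = 0) (gg : g * g = 0) (kk : k * k = 0)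
    (fg : f * g = 0) (gf : g * f = 0) (fk : f * k = 0) (kf : k * f = 0)
    (gk : g * k = 0) (kg : k * g = 0)
    (hx : (u + v + w) * (u + v + w) = 0) :
    (1 + u) * (1 + v) * (1 + w) * ((1 - f) * (1 - g) * (1 - k)) = 1 + (u + v + w) := by
  have hvu : v * u = u * v - (f + f) := by rw [← hf]; abel
  have hwu : w * u = u * w - (g + g) := by rw [← hg]; abel
  have hwv : w * v = v * w - (k + k) := by rw [← hk]; abel
  -- This is the vanishing of the square of `u + v + w`, divided by 2; `f`, `g`, `k` are the half
  -- commutators.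
  have hs : u * v + u * w + v * w = f + g + k := by
    have h0 : (u * v + u * w + v * w) - (f + g + k) + ((u * v + u * w + v * w) - (f + g + k))
        = 0 := by
      have h1 : (u + v + w) * (u + v + w) = u * u + v * v + w * w + u * v + v * u + u * w + w * u
        + v * w + w * v := by noncomm_ring
      rw [hx, huu, hvv, hww, hvu, hwu, hwv] at h1
      rw [h1]; abel
    exact sub_eq_zero.1 (h2 _ h0)
  have huvu : u * v * u = 0 := by
    rw [mul_assoc, hvu, mul_sub, ← mul_assoc, huu, mul_add, uf]; simp
  have hwuw : w * u * w = 0 := by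
    rw [hwu, sub_mul, mul_assoc, hww, add_mul, gw]; simp
  have hvwv : v * w * v = 0 := by
    rw [mul_assoc, hwv, mul_sub, ← mul_assoc, hvv, mul_add, vk]; simp
  have hwvw : w * v * w = 0 := by
    rw [hwv, sub_mul, mul_assoc, hww, add_mul, kw]; simp
  -- Multiplying `hs` by single letters shows that every cubic term that occurs is `u * v * w` up to
  -- sign, so that the cubic terms cancel at the end.
  have m1 : u * k = u * v * w := by
    have := congrArg (u * ·) hs
    simp only [mul_add, ← mul_assoc, huu, uf, ug, zero_mul, zero_add, add_zero] at this
    exact this.symm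
  have m2 : f * w = u * v * w := by
    have := congrArg (· * w) hs
    simp only [add_mul, mul_assoc, hww, gw, kw, mul_zero, add_zero] at this
    rw [← this, mul_assoc]
  have m3 : v * g = - (u * v * w) := by
    have := congrArg (v * ·) hs
    simp only [mul_add, ← mul_assoc, hvv, vf, vk, zero_mul, zero_add, add_zero] at this
    have hvuv : v * u * v = 0 := by
      rw [hvu, sub_mul, mul_assoc, hvv, add_mul, fv]; simp
    rw [← this, hvuv, hvu, sub_mul, add_mul, m2]; abel
  have m4 : g * v = u * w * v := by
    have := congrArg (· * v) hs
    simp only [add_mul, mul_assoc, hvv, fv, kv, mul_zero, add_zero, zero_add] at this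
    rw [← this, ← mul_assoc v, hvwv, mul_assoc]; simp
  have m5 : u * w * v = - (u * v * w) := by
    rw [mul_assoc, hwv, mul_sub, mul_add, m1, ← mul_assoc]; abel
  have m6 : w * f = u * v * w := by
    have := congrArg (w * ·) hs
    simp only [mul_add, ← mul_assoc, wg, wk, hwuw, hwvw, add_zero] at this
    rw [← this, hwu, sub_mul, add_mul, m4, m5]; abel
  have e1 : (1 - f) * (1 - g) * (1 - k) = 1 - (f + g + k) := by
    have : (1 - f) * (1 - g) * (1 - k) = 1 - (f + g + k) + f * g + f * k + g * k - f * g * k := by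
      noncomm_ring
    rw [this, fg, fk, gk]; simp
  have e2 : (1 + u) * (1 + v) * (1 + w) = 1 + (u + v + w) + (f + g + k) + u * v * w := by
    rw [← hs]; noncomm_ring
  have e3 : (u + v + w) * (f + g + k) = u * v * w := by
    simp only [mul_add, add_mul, uf, ug, m1, vf, m3, vk, m6, wg, wk]; abel
  have e4 : (f + g + k) * (f + g + k) = 0 := by
    simp only [mul_add, add_mul, ff, fg, fk, gf, gg, gk, kf, kg, kk]; simp
  have e5 : u * v * w * (f + g + k) = 0 := by
    simp only [mul_add, mul_assoc, wg, wk, m6, mul_zero, add_zero]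
    rw [← mul_assoc v u, ← mul_assoc u, ← mul_assoc u, huvu, zero_mul]
  rw [e1, e2]
  have : (1 + (u + v + w) + (f + g + k) + u * v * w) * (1 - (f + g + k)) =
      1 + (u + v + w) + u * v * w - (u + v + w) * (f + g + k) - (f + g + k) * (f + g + k)
        - u * v * w * (f + g + k) := by noncomm_ring
  rw [this, e3, e4, e5]; abel

/-! ### Limits of additive subgroups as groups of lowest coefficients. -/

/-- The lowest coefficients of the polynomials `P * a * Q`, where `a` runs over the polynomials
with coefficients in `S`. For `P = X + β` and `Q = X - β` with `β ^ 2 = 0` this is the limit at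
infinity of the conjugates of `S` by `1 + t * β`. -/
def limitSubgroup (P Q : R[X]) (S : AddSubgroup R) : AddSubgroup R where
  carrier := {c | ∃ a : R[X], (∀ n, a.coeff n ∈ S) ∧ ∃ j z, P * a * Q = X ^ j * z ∧ z.coeff 0 = c}
  zero_mem' := ⟨0, by simp [S.zero_mem], 0, 0, by simp, by simp⟩
  neg_mem' := by
    rintro _ ⟨a, ha, j, z, h, rfl⟩
    exact ⟨-a, fun n => by simpa using ha n, j, -z, by simp [h], by simp⟩
  add_mem' := by
    rintro _ _ ⟨a, ha, j, z, h, rfl⟩ ⟨a', ha', j', z', h', rfl⟩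
    -- The shifts bring both lowest terms to the same degree `j + j'`.
    refine ⟨X ^ j' * a + X ^ j * a', fun n => ?_, j + j', z + z', ?_, by simp⟩
    · rw [coeff_add, coeff_X_pow_mul', coeff_X_pow_mul']
      refine S.add_mem ?_ ?_ <;> split_ifs <;> simp [ha, ha', S.zero_mem]
    · rw [mul_add, add_mul, ← mul_assoc, ← X_pow_mul, mul_assoc (X ^ j'), mul_assoc (X ^ j'), h,
        ← mul_assoc P, ← X_pow_mul, mul_assoc (X ^ j), mul_assoc (X ^ j), h', mul_add, pow_add]
      rw [← mul_assoc, ← mul_assoc, ← pow_add, ← pow_add, add_comm j' j]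

theorem limitSubgroup_mono (P Q : R[X]) {S T : AddSubgroup R} (h : S ≤ T) :
    limitSubgroup P Q S ≤ limitSubgroup P Q T := by
  rintro _ ⟨a, ha, r⟩
  exact ⟨a, fun n => h (ha n), r⟩

theorem eq_of_X_pow_mul_eq {j : ℕ} {y z : R[X]} (h : X ^ j * y = X ^ j * z) : y = z := by
  ext n
  simpa [coeff_X_pow_mul] using congrArg (fun q => q.coeff (n + j)) h

/-- In the product of `P * a * Q` and `P' * a' * Q'` the inner factor `Q * P'` is the central
element `X ^ i`, which leaves `a * a' = 0`. The lowest coefficient of a product is the product of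
the lowest coefficients, if that is nonzero. -/
theorem mul_eq_zero_of_mem_limitSubgroup {P Q P' Q' : R[X]} {S T : AddSubgroup R} {i : ℕ}
    (hQP : Q * P' = X ^ i) (h : ∀ x ∈ S, ∀ y ∈ T, x * y = 0) {c d : R}
    (hc : c ∈ limitSubgroup P Q S) (hd : d ∈ limitSubgroup P' Q' T) : c * d = 0 := by
  obtain ⟨a, ha, j, z, e, rfl⟩ := hc
  obtain ⟨a', ha', j', z', e', rfl⟩ := hd
  have haa : a * a' = 0 := by
    ext n
    rw [coeff_mul, coeff_zero]
    exact Finset.sum_eq_zero fun x _ => h _ (ha _) _ (ha' _)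
  have : X ^ (j + j') * (z * z') = X ^ (j + j') * 0 := by
    calc X ^ (j + j') * (z * z') = (X ^ j * z) * (X ^ j' * z') := by
          rw [pow_add, show X ^ j * X ^ j' * (z * z') = X ^ j * (X ^ j' * z) * z' by
            simp only [mul_assoc], X_pow_mul (p := z)]
          simp only [mul_assoc]
      _ = P * a * (Q * P') * a' * Q' := by rw [← e, ← e']; simp only [mul_assoc]
      _ = P * (X ^ i * (a * a')) * Q' := by
          rw [hQP, mul_assoc P a, ← X_pow_mul]; simp only [mul_assoc]
      _ = X ^ (j + j') * 0 := by rw [haa]; simp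
  have := eq_of_X_pow_mul_eq this
  rw [← mul_coeff_zero, this, coeff_zero]

theorem finite_of_coeff_eq_zero [Finite R] (m : ℕ) (Y : AddSubgroup R[X])
    (hY : ∀ y ∈ Y, ∀ n, m ≤ n → y.coeff n = 0) : Finite Y := by
  refine Finite.of_injective (fun (y : Y) (i : Fin m) => y.1.coeff i) fun y z h => ?_
  refine Subtype.ext (Polynomial.ext fun n => ?_)
  rcases lt_or_ge n m with hn | hn
  · exact congrFun h ⟨n, hn⟩
  · rw [hY _ y.2 n hn, hY _ z.2 n hn]

/-- An additive group of polynomials of degree less than `m` all of whose lowest coefficients lie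
in `T` has at most `|T| ^ m` elements. -/
theorem card_le_of_lowest_coeff_mem [Finite R] (T : AddSubgroup R) (m : ℕ) :
    ∀ Y : AddSubgroup R[X], (∀ y ∈ Y, ∀ n, m ≤ n → y.coeff n = 0) →
      (∀ j z, X ^ j * z ∈ Y → z.coeff 0 ∈ T) → Nat.card Y ≤ Nat.card T ^ m := by
  induction m with
  | zero =>
    intro Y hY _
    have : Y = ⊥ := by
      rw [eq_bot_iff]
      intro y hy
      exact Polynomial.ext fun n => by simpa using hY y hy n (Nat.zero_le _)
    subst this
    simp
  | succ m ih =>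
    intro Y hY hT
    -- `Y'` consists of the quotients by `X` of the members of `Y` without constant term; it has one
    -- degree less, and its lowest coefficients are still in `T`.
    let Y' : AddSubgroup R[X] := Y.comap (AddMonoidHom.mulLeft (X : R[X]))
    have hY' : ∀ y ∈ Y', ∀ n, m ≤ n → y.coeff n = 0 := fun y hy n hn => by
      have := hY _ hy (n + 1) (by omega)
      rwa [AddMonoidHom.coe_mulLeft, coeff_X_mul] at this
    have hc := ih Y' hY' (fun j z hz => hT (j + 1) z (by
        have : X * (X ^ j * z) ∈ Y := hz
        rwa [← mul_assoc, ← pow_succ'] at this))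
    have := finite_of_coeff_eq_zero m Y' hY'
    let φ : Y →+ R := (lcoeff R 0).toAddMonoidHom.comp Y.subtype
    have h1 : Nat.card φ.range ≤ Nat.card T := by
      refine AddSubgroup.card_le_of_le ?_
      rintro _ ⟨y, rfl⟩
      exact hT 0 y.1 (by simp)
    have h2 : Nat.card φ.ker ≤ Nat.card Y' := by
      refine Nat.card_le_card_of_surjective
        (fun y : Y' => (⟨⟨X * y.1, y.2⟩, by simp [φ, AddMonoidHom.mem_ker]⟩ : φ.ker)) ?_
      rintro ⟨⟨y, hy⟩, h⟩
      have h0 : y.coeff 0 = 0 := h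
      have : X * y.divX = y := by
        conv_rhs => rw [← X_mul_divX_add y, h0]
        simp
      exact ⟨⟨y.divX, by change X * y.divX ∈ Y; rwa [this]⟩, by simp [this]⟩
    rw [← φ.ker.card_mul_index, AddSubgroup.index_ker, pow_succ]
    exact Nat.mul_le_mul (h2.trans hc) h1

/-- Multiplication by the monic `P` and `Q` embeds the polynomials of degree less than `n` over `S`
into those of degree less than `n + 2`, and the image has its lowest coefficients in `T`. Thus `|S|
^ n ≤ |T| ^ (n + 2)` for all `n`, and large `n` forces `|S| ≤ |T|`. -/
theorem card_le_card_limitSubgroup [Finite R] {P Q : R[X]} (hP : P.Monic) (hQ : Q.Monic)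
    (hP1 : P.natDegree ≤ 1) (hQ1 : Q.natDegree ≤ 1) (S : AddSubgroup R) :
    Nat.card S ≤ Nat.card (limitSubgroup P Q S) := by
  set T := limitSubgroup P Q S
  have key : ∀ n, Nat.card S ^ n ≤ Nat.card T ^ (n + 2) := by
    intro n
    let Y₀ : AddSubgroup R[X] :=
      { carrier := {a | (∀ i, a.coeff i ∈ S) ∧ ∀ i, n ≤ i → a.coeff i = 0}
        zero_mem' := by simp [S.zero_mem]
        add_mem' := fun {a b} ha hb => ⟨fun i => by simpa using S.add_mem (ha.1 i) (hb.1 i),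
          fun i hi => by simp [ha.2 i hi, hb.2 i hi]⟩
        neg_mem' := fun {a} ha => ⟨fun i => by simpa using ha.1 i,
          fun i hi => by simp [ha.2 i hi]⟩ }
    let ψ : R[X] →+ R[X] := (AddMonoidHom.mulRight Q).comp (AddMonoidHom.mulLeft P)
    have hψ : Function.Injective ψ := fun a b h => hP.isRegular.left (hQ.isRegular.right h)
    have hdeg : ∀ y ∈ Y₀.map ψ, ∀ i, n + 2 ≤ i → y.coeff i = 0 := by
      rintro _ ⟨a, ha, rfl⟩ i hi
      rcases Nat.eq_zero_or_pos n with rfl | hn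
      · have : a = 0 := Polynomial.ext fun i => ha.2 i (Nat.zero_le _)
        simp [this]
      · refine coeff_eq_zero_of_natDegree_lt ?_
        have h1 : a.natDegree ≤ n - 1 := natDegree_le_iff_coeff_eq_zero.2 fun i hi =>
          ha.2 i (by omega)
        have h2 : (P * a * Q).natDegree ≤ _ := natDegree_mul_le
        have h3 : (P * a).natDegree ≤ _ := natDegree_mul_le
        change (P * a * Q).natDegree < i
        omega
    have hc := card_le_of_lowest_coeff_mem T (n + 2) (Y₀.map ψ) hdeg (by
      rintro j z ⟨a, ha, h⟩
      exact ⟨a, ha.1, j, z, h, rfl⟩)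
    have := finite_of_coeff_eq_zero n Y₀ fun a ha => ha.2
    have h4 : Nat.card (Y₀.map ψ) = Nat.card Y₀ :=
      (Nat.card_congr (Y₀.equivMapOfInjective ψ hψ).toEquiv).symm
    refine le_trans ?_ (h4 ▸ hc)
    have h5 : Nat.card S ^ n = Nat.card (Fin n → S) := by
      rw [Nat.card_fun, Nat.card_fin]
    rw [h5]
    have hco : ∀ (f : Fin n → S) (i : ℕ), (∑ k : Fin n, monomial (k : ℕ) (f k : R)).coeff i =
        if h : i < n then (f ⟨i, h⟩ : R) else 0 := by
      intro f i
      rw [finsetSum_coeff]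
      simp only [coeff_monomial]
      split_ifs with h
      · rw [Finset.sum_eq_single ⟨i, h⟩]
        · simp
        · intro b _ hb
          rw [if_neg]
          exact fun h' => hb (Fin.ext h')
        · simp
      · exact Finset.sum_eq_zero fun k _ => if_neg (by omega)
    refine Nat.card_le_card_of_injective (fun f : Fin n → S =>
      (⟨∑ k : Fin n, monomial (k : ℕ) (f k : R), fun i => ?_, fun i hi => ?_⟩ : Y₀)) ?_
    · rw [hco]; split_ifs <;> simp [S.zero_mem]
    · rw [hco, dif_neg (by omega)]
    · intro f g h
      ext i
      have := congrArg (fun q : Y₀ => q.1.coeff i) h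
      simpa [hco] using this
  by_contra! hlt
  set c := Nat.card T
  have hc : 0 < c := Nat.card_pos
  have bern : ∀ m, c ^ (m + 1) + (m + 1) * c ^ m ≤ (c + 1) ^ (m + 1) := by
    intro m
    induction m with
    | zero => simp
    | succ m ih =>
      calc c ^ (m + 2) + (m + 2) * c ^ (m + 1)
          ≤ (c ^ (m + 1) + (m + 1) * c ^ m) * (c + 1) := by
            ring_nf
            omega
        _ ≤ _ := by rw [pow_succ (c + 1) (m + 1)]; exact Nat.mul_le_mul_right _ ih
  -- With exponent `n = c ^ 3`, the linear term of Bernoulli's inequality for `(c + 1) ^ n` is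
  -- already `c ^ (n + 2)`, the upper bound from `key`.
  obtain ⟨m, hm⟩ : ∃ m, c ^ 3 = m + 1 := Nat.exists_eq_succ_of_ne_zero (by positivity)
  have h1 : (c + 1) ^ (m + 1) ≤ c ^ (m + 1) * c ^ 2 := by
    rw [← pow_add]
    exact (Nat.pow_le_pow_left hlt _).trans (key _)
  have h2 : c ^ (m + 1) + c ^ (m + 1) * c ^ 2 ≤ (c + 1) ^ (m + 1) := by
    have e : (m + 1) * c ^ m = c ^ (m + 1) * c ^ 2 := by
      calc _ = c ^ 3 * c ^ m := by rw [hm]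
        _ = _ := by ring
    exact e ▸ bern m
  have h3 : 0 < c ^ (m + 1) := by positivity
  omega

end Ring

/-! ### Quadratic subgroups and their logarithms. -/

section Representation

variable {R G : Type*} [Ring R] [Group G] (ρ : G →* R)

/-- `E` acts quadratically through `ρ`: the product of any two elements of `ρ(E) - 1` vanishes. -/
def IsQuadraticOn (E : Subgroup G) : Prop :=
  ∀ e ∈ E, ∀ f ∈ E, (ρ e - 1) * (ρ f - 1) = 0

variable {ρ}

theorem IsQuadraticOn.mono {E F : Subgroup G} (h : IsQuadraticOn ρ E) (hF : F ≤ E) :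
    IsQuadraticOn ρ F := fun e he f hf => h e (hF he) f (hF hf)

theorem IsQuadraticOn.map_mul_sub_one {E : Subgroup G} (h : IsQuadraticOn ρ E) {e f : G}
    (he : e ∈ E) (hf : f ∈ E) : ρ (e * f) - 1 = (ρ e - 1) + (ρ f - 1) := by
  have := h e he f hf
  have h1 : ρ (e * f) - 1 = (ρ e - 1) * (ρ f - 1) + ((ρ e - 1) + (ρ f - 1)) := by
    rw [map_mul]; noncomm_ring
  rw [h1, this, zero_add]

theorem IsQuadraticOn.map_inv_sub_one {E : Subgroup G} (h : IsQuadraticOn ρ E) {e : G}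
    (he : e ∈ E) : ρ e⁻¹ - 1 = - (ρ e - 1) := by
  have := h.map_mul_sub_one he (E.inv_mem he)
  rw [mul_inv_cancel, map_one, sub_self] at this
  exact (neg_eq_of_add_eq_zero_right this.symm).symm

theorem IsQuadraticOn.map_pow_sub_one {E : Subgroup G} (h : IsQuadraticOn ρ E) {e : G}
    (he : e ∈ E) (n : ℕ) : ρ (e ^ n) - 1 = n • (ρ e - 1) := by
  induction n with
  | zero => simp
  | succ n ih => rw [pow_succ, h.map_mul_sub_one (E.pow_mem he n) he, ih, succ_nsmul]

theorem IsQuadraticOn.conj {E : Subgroup G} (h : IsQuadraticOn ρ E) (b : G) :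
    IsQuadraticOn ρ (E.map (MulAut.conj b).toMonoidHom) := by
  rintro _ ⟨e, he, rfl⟩ _ ⟨f, hf, rfl⟩
  have hb : ρ b⁻¹ * ρ b = 1 := by rw [← map_mul]; simp
  have hb' : ρ b * ρ b⁻¹ = 1 := by rw [← map_mul]; simp
  have key : ∀ x, ρ ((MulAut.conj b).toMonoidHom x) - 1 = ρ b * (ρ x - 1) * ρ b⁻¹ := by
    intro x
    simp [mul_sub, sub_mul, hb']
  rw [key, key]
  calc _ = ρ b * (ρ e - 1) * (ρ b⁻¹ * ρ b) * (ρ f - 1) * ρ b⁻¹ := by simp only [mul_assoc]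
    _ = ρ b * ((ρ e - 1) * (ρ f - 1)) * ρ b⁻¹ := by rw [hb, mul_one]; simp only [mul_assoc]
    _ = 0 := by rw [h e he f hf]; simp

/-- The additive group `ρ(E) - 1` of a quadratic subgroup `E`. -/
def IsQuadraticOn.log {E : Subgroup G} (h : IsQuadraticOn ρ E) : AddSubgroup R where
  carrier := {x | ∃ e ∈ E, ρ e - 1 = x}
  zero_mem' := ⟨1, E.one_mem, by simp⟩
  add_mem' := by
    rintro _ _ ⟨e, he, rfl⟩ ⟨f, hf, rfl⟩
    exact ⟨e * f, E.mul_mem he hf, h.map_mul_sub_one he hf⟩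
  neg_mem' := by
    rintro _ ⟨e, he, rfl⟩
    exact ⟨e⁻¹, E.inv_mem he, h.map_inv_sub_one he⟩

theorem IsQuadraticOn.card_log (hρ : Function.Injective ρ) {E : Subgroup G}
    (h : IsQuadraticOn ρ E) : Nat.card h.log = Nat.card E := by
  refine (Nat.card_congr (Equiv.ofBijective
    (fun e : E => (⟨ρ e - 1, e, e.2, rfl⟩ : h.log)) ⟨fun e f hef => ?_, ?_⟩)).symm
  · exact Subtype.ext (hρ (sub_left_injective (congrArg Subtype.val hef)))
  · rintro ⟨_, e, he, rfl⟩
    exact ⟨⟨e, he⟩, rfl⟩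

/-- If two quadratic subgroups contain a commutator of two of their elements, then that commutator
is given by the ring commutator. -/
theorem map_commutatorElement_sub_one {E F : Subgroup G} (hE : IsQuadraticOn ρ E)
    (hF : IsQuadraticOn ρ F) {e f : G} (he : e ∈ E) (hf : f ∈ F) (hc : ⁅e, f⁆ ∈ E ⊓ F) :
    ρ ⁅e, f⁆ - 1 = (ρ e - 1) * (ρ f - 1) - (ρ f - 1) * (ρ e - 1) := by
  have h1 : ρ ⁅e, f⁆ * (ρ f * ρ e) = ρ e * ρ f := by
    rw [← map_mul, ← map_mul, ← map_mul]; congr 1; rw [commutatorElement_def]; group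
  have h2 := hE _ hc.1 e he
  have h3 := hF _ hc.2 f hf
  generalize ρ ⁅e, f⁆ = c at *
  -- As `c - 1` annihilates `ρ e - 1` and `ρ f - 1`, only `c - 1` survives on the right, while the
  -- left side is `ρ e * ρ f - ρ f * ρ e`.
  have h4 : (c - 1) * (ρ f * ρ e) = (c - 1) + (c - 1) * (ρ f - 1) * (ρ e - 1)
      + (c - 1) * (ρ f - 1) + (c - 1) * (ρ e - 1) := by noncomm_ring
  rw [h3, h2, zero_mul, add_zero, add_zero, add_zero] at h4
  rw [← h4, sub_mul, h1]
  noncomm_ring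

/-- For three quadratic subgroups which normalize each other, a sum of elements of their logarithms
with square zero is again the logarithm of a group element. -/
theorem map_mul_commutators_eq_one_add {h : ℕ} (hR : ∀ y : R, (2 * h + 1) • y = 0)
    {E F K : Subgroup G} (hE : IsQuadraticOn ρ E) (hF : IsQuadraticOn ρ F)
    (hK : IsQuadraticOn ρ K) {e f k : G} (he : e ∈ E) (hf : f ∈ F) (hk : k ∈ K)
    (hef : ⁅e, f⁆ ∈ E ⊓ F) (hek : ⁅e, k⁆ ∈ E ⊓ K) (hfk : ⁅f, k⁆ ∈ F ⊓ K)
    (hx : ((ρ e - 1) + (ρ f - 1) + (ρ k - 1)) * ((ρ e - 1) + (ρ f - 1) + (ρ k - 1)) = 0) :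
    ρ (e * f * k * (⁅e, f⁆ ^ h * ⁅e, k⁆ ^ h * ⁅f, k⁆ ^ h)) =
      1 + ((ρ e - 1) + (ρ f - 1) + (ρ k - 1)) := by
  have h2 : ∀ y : R, y + y = 0 → y = 0 := by
    intro y hy
    have := hR y
    rwa [add_nsmul, one_nsmul, two_mul, add_nsmul, ← smul_add, hy, smul_zero, zero_add] at this
  -- Since `2 * h + 1` kills `R`, multiplication by `-h` is division by 2. Hence `c ^ h` in the
  -- group has minus half the logarithm of `c`.
  have hhalf : ∀ c : R, c = -(h • c) + -(h • c) := by
    intro c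
    have := hR c
    rw [add_nsmul, one_nsmul, two_mul, add_nsmul] at this
    rw [← neg_add, eq_neg_iff_add_eq_zero, add_comm]; exact this
  have hpow : ∀ {E : Subgroup G} (hE : IsQuadraticOn ρ E) {c : G} (hc : c ∈ E),
      ρ (c ^ h) = 1 - -(h • (ρ c - 1)) := by
    intro E hE c hc
    have := hE.map_pow_sub_one hc h
    rw [← this]; abel
  have z : ∀ {E : Subgroup G} (hE : IsQuadraticOn ρ E) {c d : G} (hc : c ∈ E) (hd : d ∈ E),
      (ρ c - 1) * -(h • (ρ d - 1)) = 0 ∧ -(h • (ρ c - 1)) * (ρ d - 1) = 0 ∧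
      -(h • (ρ c - 1)) * -(h • (ρ d - 1)) = 0 := by
    intro E hE c d hc hd
    have := hE c hc d hd
    simp only [mul_neg, neg_mul, mul_smul_comm, smul_mul_assoc, this, smul_zero, neg_zero,
      and_self]
  rw [map_mul, map_mul, map_mul, map_mul, map_mul, hpow hE hef.1, hpow hE hek.1, hpow hF hfk.1]
  have := one_add_mul_one_add_mul_one_add_of_sq_zero h2 (u := ρ e - 1) (v := ρ f - 1)
    (w := ρ k - 1) (f := -(h • (ρ ⁅e, f⁆ - 1))) (g := -(h • (ρ ⁅e, k⁆ - 1)))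
    (k := -(h • (ρ ⁅f, k⁆ - 1))) (hE e he e he) (hF f hf f hf) (hK k hk k hk)
    (by rw [← map_commutatorElement_sub_one hE hF he hf hef]; exact hhalf _)
    (by rw [← map_commutatorElement_sub_one hE hK he hk hek]; exact hhalf _)
    (by rw [← map_commutatorElement_sub_one hF hK hf hk hfk]; exact hhalf _)
    (z hE he hef.1).1 (z hF hf hef.2).1 (z hF hef.2 hf).2.1
    (z hE he hek.1).1 (z hK hk hek.2).1 (z hK hek.2 hk).2.1
    (z hF hf hfk.1).1 (z hF hfk.1 hf).2.1 (z hK hk hfk.2).1 (z hK hfk.2 hk).2.1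
    (z hE hef.1 hef.1).2.2 (z hE hek.1 hek.1).2.2 (z hF hfk.1 hfk.1).2.2
    (z hE hef.1 hek.1).2.2 (z hE hek.1 hef.1).2.2
    (z hF hef.2 hfk.1).2.2 (z hF hfk.1 hef.2).2.2
    (z hK hek.2 hfk.2).2.2 (z hK hfk.2 hek.2).2.2 hx
  rw [← this]
  simp

end Representation

/-! ### The limit under conjugation by `1 + tβ` with `β` of square zero. -/

section Limit

variable {R : Type*} [Ring R]

theorem X_sub_C_mul_X_add_C_of_sq_zero {β : R} (hβ : β * β = 0) :
    (X - C β) * (X + C β) = (X : R[X]) ^ 2 ∧ (X + C β) * (X - C β) = (X : R[X]) ^ 2 := by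
  have h1 : (C β * C β : R[X]) = 0 := by rw [← C_mul, hβ, C_0]
  have h2 : (X : R[X]) * C β = C β * X := X_mul_C β
  constructor
  · rw [sub_mul, mul_add, mul_add, h1, h2, sq]; abel
  · rw [add_mul, mul_sub, mul_sub, h1, h2, sq]; abel

theorem X_add_C_mul_mul_X_sub_C (β : R) (a : R[X]) :
    (X + C β) * a * (X - C β) = X * (X * a) + (C β * (X * a) - X * a * C β) - C β * a * C β := by
  have h : (X * a * X : R[X]) = X * (X * a) := by rw [X_mul (p := X * a)]
  have h' : (C β * a * X : R[X]) = C β * (X * a) := by rw [mul_assoc, X_mul (p := a)]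
  rw [add_mul, add_mul, mul_sub, mul_sub, h, h']; abel

/-- Only the coefficient of `X ^ j` in `(X + C β) * a * (X - C β)` is needed; it involves the
coefficients of `a` in degrees `j - 2`, `j - 1` and `j`, those of negative degree being zero. -/
theorem exists_of_mem_limitSubgroup {β c : R} {S : AddSubgroup R}
    (hc : c ∈ limitSubgroup (X + C β) (X - C β) S) :
    ∃ a₀ ∈ S, ∃ a₁ ∈ S, ∃ a₂ ∈ S, a₀ + (β * a₁ - a₁ * β) - β * a₂ * β = c := by
  obtain ⟨a, ha, j, z, h, rfl⟩ := hc
  have hX : ∀ q : R[X], (∀ n, q.coeff n ∈ S) → ∀ n, (X * q).coeff n ∈ S := by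
    rintro q hq (_ | n)
    · simp [S.zero_mem]
    · simpa using hq n
  refine ⟨_, hX _ (hX a ha) j, _, hX a ha j, _, ha j, ?_⟩
  have := congrArg (fun q => q.coeff j) h
  rw [X_add_C_mul_mul_X_sub_C] at this
  simpa [coeff_X_pow_mul'] using this

/-- The witness is `a` conjugated the opposite way, `(X - C β) * C a * (X + C β)`, whose
coefficients lie in `S` by the invariance hypotheses. This is what puts invariant elements of `S`
into the limit. -/
theorem exists_polynomial_of_invariant {β a : R} (hβ : β * β = 0) {S : AddSubgroup R}
    (ha : a ∈ S) (h1 : β * a - a * β ∈ S) (h2 : β * a * β ∈ S) :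
    ∃ y : R[X], (∀ n, y.coeff n ∈ S) ∧ (X + C β) * y * (X - C β) = X ^ 4 * C a := by
  refine ⟨(X - C β) * C a * (X + C β), fun n => ?_, ?_⟩
  · have := X_add_C_mul_mul_X_sub_C (-β) (C a)
    rw [C_neg, ← sub_eq_add_neg, sub_neg_eq_add] at this
    rw [this]
    have e : X * (X * C a) + (-C β * (X * C a) - X * C a * -C β) - -C β * C a * -C β =
        X ^ 2 * C a - X ^ 1 * C (β * a - a * β) - X ^ 0 * C (β * a * β) := by
      have hX : C β * (X * C a) = X * (C β * C a) := by rw [← mul_assoc, ← X_mul, mul_assoc]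
      rw [neg_mul, hX, C_sub, C_mul, C_mul, C_mul, C_mul]
      noncomm_ring
    rw [e, coeff_sub, coeff_sub]
    simp only [coeff_X_pow_mul', coeff_C]
    refine S.sub_mem (S.sub_mem ?_ ?_) ?_ <;> split_ifs <;> simp [S.zero_mem, ha, h1, h2]
  · obtain ⟨e1, e2⟩ := X_sub_C_mul_X_add_C_of_sq_zero hβ
    calc _ = ((X + C β) * (X - C β)) * C a * ((X + C β) * (X - C β)) := by
          simp only [mul_assoc]
      _ = X ^ 4 * C a := by rw [e2, mul_assoc, ← X_pow_mul, ← mul_assoc, ← pow_add]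

end Limit

/-! ### Elements of the limit are logarithms of group elements. -/

section Representation

variable {R G : Type*} [Ring R] [Group G] {ρ : G →* R}

theorem map_inv_of_sq_zero {b : G} (hb : (ρ b - 1) * (ρ b - 1) = 0) :
    ρ b⁻¹ = 1 - (ρ b - 1) := by
  have h1 : ρ b⁻¹ * ρ b = 1 := by rw [← map_mul]; simp
  have h2 : ρ b * (1 - (ρ b - 1)) = 1 := by
    have : ρ b * (1 - (ρ b - 1)) = 1 - (ρ b - 1) * (ρ b - 1) := by noncomm_ring
    rw [this, hb, sub_zero]
  exact left_inv_eq_right_inv h1 h2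

theorem map_conj_sub_one {b : G} (hb : (ρ b - 1) * (ρ b - 1) = 0) (y : G) :
    ρ (b * y * b⁻¹) - 1 = (ρ y - 1) + ((ρ b - 1) * (ρ y - 1) - (ρ y - 1) * (ρ b - 1))
      - (ρ b - 1) * (ρ y - 1) * (ρ b - 1) := by
  rw [map_mul, map_mul, map_inv_of_sq_zero hb]
  have : ρ b * ρ y * (1 - (ρ b - 1)) - 1 = (ρ y - 1) +
      ((ρ b - 1) * (ρ y - 1) - (ρ y - 1) * (ρ b - 1)) - (ρ b - 1) * (ρ y - 1) * (ρ b - 1)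
      - (ρ b - 1) * (ρ b - 1) := by noncomm_ring
  rw [this, hb, sub_zero]

theorem map_conj_inv_sub_one {b : G} (hb : (ρ b - 1) * (ρ b - 1) = 0) (y : G) :
    ρ (b⁻¹ * y * b) - 1 = (ρ y - 1) - ((ρ b - 1) * (ρ y - 1) - (ρ y - 1) * (ρ b - 1))
      - (ρ b - 1) * (ρ y - 1) * (ρ b - 1) := by
  have e : ρ b⁻¹ - 1 = - (ρ b - 1) := by rw [map_inv_of_sq_zero hb]; abel
  have := map_conj_sub_one (ρ := ρ) (b := b⁻¹) (by rw [e, neg_mul_neg, hb]) y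
  rw [inv_inv, e] at this
  rw [this]
  noncomm_ring

/-- Two subgroups that normalize each other contain the commutators of their elements in their
intersection; a common conjugation reduces any pair of conjugates of `E` to the case in `hN`. -/
theorem commutatorElement_mem_of_conj_mem {E : Subgroup G} {b : G}
    (hN : ∀ k ∈ Subgroup.zpowers b, ∀ e ∈ E, ∀ f ∈ E, k * e * k⁻¹ * f * (k * e * k⁻¹)⁻¹ ∈ E)
    {k l : G} (hk : k ∈ Subgroup.zpowers b) (hl : l ∈ Subgroup.zpowers b)
    {e f : G} (he : e ∈ E.map (MulAut.conj k).toMonoidHom)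
    (hf : f ∈ E.map (MulAut.conj l).toMonoidHom) :
    ⁅e, f⁆ ∈ E.map (MulAut.conj k).toMonoidHom ⊓ E.map (MulAut.conj l).toMonoidHom := by
  have key : ∀ {k l : G}, k ∈ Subgroup.zpowers b → l ∈ Subgroup.zpowers b →
      ∀ {e f : G}, e ∈ E.map (MulAut.conj k).toMonoidHom →
      f ∈ E.map (MulAut.conj l).toMonoidHom →
      e * f * e⁻¹ ∈ E.map (MulAut.conj l).toMonoidHom := by
    rintro k l hk hl _ _ ⟨e, he, rfl⟩ ⟨f, hf, rfl⟩
    refine ⟨_, hN (l⁻¹ * k) (mul_mem (inv_mem hl) hk) e he f hf, ?_⟩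
    simp only [MulEquiv.coe_toMonoidHom, MulAut.conj_apply]
    group
  rw [commutatorElement_def]
  refine ⟨?_, Subgroup.mul_mem _ (key hk hl he hf) (inv_mem hf)⟩
  rw [mul_assoc, mul_assoc, ← mul_assoc f]
  exact Subgroup.mul_mem _ he (key hl hk hf (inv_mem he))

/-- Suppose that the conjugates of the quadratic group `E` by the powers of the quadratic element
`b` normalize each other. If an element of the form of a lowest coefficient of a conjugate of a
polynomial over `ρ(E) - 1` has square zero, then it lies in `ρ(G) - 1`. -/
theorem exists_map_sub_one_eq {h : ℕ} (hR : ∀ y : R, (2 * h + 1) • y = 0)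
    {E : Subgroup G} (hE : IsQuadraticOn ρ E) {b : G} (hb : (ρ b - 1) * (ρ b - 1) = 0)
    (hN : ∀ k ∈ Subgroup.zpowers b, ∀ e ∈ E, ∀ f ∈ E, k * e * k⁻¹ * f * (k * e * k⁻¹)⁻¹ ∈ E)
    {e₀ e₁ e₂ : G} (h₀ : e₀ ∈ E) (h₁ : e₁ ∈ E) (h₂ : e₂ ∈ E) {c : R}
    (hc : (ρ e₀ - 1) + ((ρ b - 1) * (ρ e₁ - 1) - (ρ e₁ - 1) * (ρ b - 1))
      - (ρ b - 1) * (ρ e₂ - 1) * (ρ b - 1) = c) (hcc : c * c = 0) :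
    ∃ g, ρ g - 1 = c ∧ ∀ K : Subgroup G, K.Normal → e₀ ∈ K → (∀ x, ⁅e₁, x⁆ ∈ K) →
      (∀ x, ⁅e₂, x⁆ ∈ K) → g ∈ K := by
  -- The power `h + 1` halves logarithms, so `y` and `z` have logarithms with sum that of `e₂` and
  -- difference that of `e₁`. Conjugating `y` by `b` and `z` by `b⁻¹` then produces both terms of
  -- `c` involving `ρ b - 1`, and `w` corrects the remaining one.
  set y := (e₁ * e₂) ^ (h + 1) with hy
  set z := (e₂ * e₁⁻¹) ^ (h + 1) with hz
  have hyE : y ∈ E := E.pow_mem (E.mul_mem h₁ h₂) _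
  have hzE : z ∈ E := E.pow_mem (E.mul_mem h₂ (E.inv_mem h₁)) _
  have hdbl : ∀ x : R, (h + 1) • (x + x) = x := by
    intro x
    have := hR x
    rw [smul_add, ← add_nsmul, show h + 1 + (h + 1) = (2 * h + 1) + 1 by ring, add_nsmul, this,
      zero_add, one_nsmul]
  have ly : ρ y - 1 = (h + 1) • ((ρ e₁ - 1) + (ρ e₂ - 1)) := by
    rw [hy, hE.map_pow_sub_one (E.mul_mem h₁ h₂), hE.map_mul_sub_one h₁ h₂]
  have lz : ρ z - 1 = (h + 1) • ((ρ e₂ - 1) - (ρ e₁ - 1)) := by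
    rw [hz, hE.map_pow_sub_one (E.mul_mem h₂ (E.inv_mem h₁)),
      hE.map_mul_sub_one h₂ (E.inv_mem h₁), hE.map_inv_sub_one h₁, sub_eq_add_neg _ (ρ e₁ - 1)]
  have hadd : (ρ y - 1) + (ρ z - 1) = ρ e₂ - 1 := by
    rw [ly, lz, ← smul_add, ← hdbl (ρ e₂ - 1)]; congr 1; rw [hdbl]; abel
  have hsub : (ρ y - 1) - (ρ z - 1) = ρ e₁ - 1 := by
    rw [ly, lz, ← smul_sub, ← hdbl (ρ e₁ - 1)]; congr 1; rw [hdbl]; abel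
  set w := e₀ * (y * z)⁻¹ with hw
  have hwE : w ∈ E := E.mul_mem h₀ (E.inv_mem (E.mul_mem hyE hzE))
  have lw : ρ w - 1 = (ρ e₀ - 1) - (ρ e₂ - 1) := by
    rw [hw, hE.map_mul_sub_one h₀ (E.inv_mem (E.mul_mem hyE hzE)),
      hE.map_inv_sub_one (E.mul_mem hyE hzE), hE.map_mul_sub_one hyE hzE, hadd, ← sub_eq_add_neg]
  have hsum : (ρ w - 1) + (ρ (b * y * b⁻¹) - 1) + (ρ (b⁻¹ * z * b) - 1) = c := by
    rw [map_conj_sub_one hb, map_conj_inv_sub_one hb, lw, ← hc, ← hadd, ← hsub]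
    noncomm_ring
  have mw : w ∈ E.map (MulAut.conj (1 : G)).toMonoidHom := ⟨w, hwE, by simp⟩
  have my : b * y * b⁻¹ ∈ E.map (MulAut.conj b).toMonoidHom := ⟨y, hyE, by simp⟩
  have mz : b⁻¹ * z * b ∈ E.map (MulAut.conj b⁻¹).toMonoidHom := ⟨z, hzE, by simp⟩
  have b1 : (1 : G) ∈ Subgroup.zpowers b := one_mem _
  have bb : b ∈ Subgroup.zpowers b := Subgroup.mem_zpowers b
  have bi : b⁻¹ ∈ Subgroup.zpowers b := inv_mem bb
  have main := map_mul_commutators_eq_one_add hR (hE.conj 1) (hE.conj b) (hE.conj b⁻¹) mw my mz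
    (commutatorElement_mem_of_conj_mem hN b1 bb mw my)
    (commutatorElement_mem_of_conj_mem hN b1 bi mw mz)
    (commutatorElement_mem_of_conj_mem hN bb bi my mz) (by rw [hsum]; exact hcc)
  refine ⟨_, by rw [main, hsum]; abel, fun K hK k₀ k₁ k₂ => ?_⟩
  -- Modulo `K` the elements `e₁`, `e₂`, and hence `y`, `z`, are central and `e₀` is trivial, so
  -- conjugations and commutators disappear and the product is `(y * z)⁻¹ * y * z`.
  rw [← QuotientGroup.eq_one_iff]
  have hcomm : ∀ {e : G}, (∀ x, ⁅e, x⁆ ∈ K) → ∀ q : G ⧸ K, Commute (e : G ⧸ K) q := by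
    intro e he q
    obtain ⟨x, rfl⟩ := QuotientGroup.mk_surjective q
    have := (QuotientGroup.eq_one_iff _).2 (he x)
    rw [← commutatorElement_eq_one_iff_commute]
    exact this
  have c₁ := hcomm k₁
  have c₂ := hcomm k₂
  have cy : ∀ q : G ⧸ K, Commute (y : G ⧸ K) q := fun q => by
    simpa [hy] using ((c₁ q).mul_left (c₂ q)).pow_left _
  have cz : ∀ q : G ⧸ K, Commute (z : G ⧸ K) q := fun q => by
    simpa [hz] using ((c₂ q).mul_left (c₁ q).inv_left).pow_left _
  have qy : ((b * y * b⁻¹ : G) : G ⧸ K) = y := by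
    simp only [QuotientGroup.mk_mul, QuotientGroup.mk_inv]
    rw [← (cy b).eq, mul_inv_cancel_right]
  have qz : ((b⁻¹ * z * b : G) : G ⧸ K) = z := by
    simp only [QuotientGroup.mk_mul, QuotientGroup.mk_inv]
    rw [← (cz _).eq, inv_mul_cancel_right]
  have q0 : (e₀ : G ⧸ K) = 1 := (QuotientGroup.eq_one_iff _).2 k₀
  have qw : (w : G ⧸ K) = ((y : G ⧸ K) * z)⁻¹ := by
    rw [hw, QuotientGroup.mk_mul, q0, one_mul, QuotientGroup.mk_inv, QuotientGroup.mk_mul]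
  have comm : ∀ {u v : G}, Commute (u : G ⧸ K) v → ((⁅u, v⁆ : G) : G ⧸ K) = 1 := by
    intro u v huv
    exact commutatorElement_eq_one_iff_commute.2 huv
  clear_value w y z
  generalize b * y * b⁻¹ = y' at *
  generalize b⁻¹ * z * b = z' at *
  simp only [QuotientGroup.mk_mul, QuotientGroup.mk_pow]
  rw [comm (by rw [qy]; exact (cy _).symm), comm (by rw [qz]; exact (cz _).symm),
    comm (by rw [qy]; exact cy _), qy, qz, qw]
  simp

end Representation

theorem X_add_C_mul_C_mul_X_sub_C {R : Type*} [Ring R] (β a : R) :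
    (X + C β) * C a * (X - C β) = X ^ 2 * C a + X * C (β * a - a * β) - C (β * a * β) := by
  have hX : C β * (X * C a) = X * (C β * C a) := by rw [← mul_assoc, ← X_mul, mul_assoc]
  rw [X_add_C_mul_mul_X_sub_C, hX, C_sub, C_mul, C_mul, C_mul, C_mul]
  noncomm_ring

/-! ### The replacement of `E` by the group of its limit. -/

section Representation

variable {R G : Type*} [Ring R] [Group G]

/-- The elements `g` with `ρ g - 1 ∈ T`, for an additive group `T` with zero multiplication. -/
def expSubgroup (ρ : G →* R) (T : AddSubgroup R) (hT : ∀ x ∈ T, ∀ y ∈ T, x * y = 0) :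
    Subgroup G where
  carrier := {g | ρ g - 1 ∈ T}
  one_mem' := by simp [T.zero_mem]
  mul_mem' := by
    intro a b (ha : ρ a - 1 ∈ T) (hb : ρ b - 1 ∈ T)
    have : ρ (a * b) - 1 = (ρ a - 1) * (ρ b - 1) + ((ρ a - 1) + (ρ b - 1)) := by
      rw [map_mul]; noncomm_ring
    change ρ (a * b) - 1 ∈ T
    rw [this, hT _ ha _ hb, zero_add]
    exact T.add_mem ha hb
  inv_mem' := by
    intro a (ha : ρ a - 1 ∈ T)
    change ρ a⁻¹ - 1 ∈ T
    rw [map_inv_of_sq_zero (hT _ ha _ ha)]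
    simpa using T.neg_mem ha

variable {ρ : G →* R}

theorem mem_expSubgroup {T : AddSubgroup R} {hT : ∀ x ∈ T, ∀ y ∈ T, x * y = 0} {g : G} :
    g ∈ expSubgroup ρ T hT ↔ ρ g - 1 ∈ T := Iff.rfl

theorem card_le_card_expSubgroup_inf [Finite G] {T S : AddSubgroup R}
    {hT : ∀ x ∈ T, ∀ y ∈ T, x * y = 0} {K : Subgroup G}
    (hST : S ≤ T) (hS : ∀ c ∈ S, ∃ g ∈ K, ρ g - 1 = c) :
    Nat.card S ≤ Nat.card (expSubgroup ρ T hT ⊓ K : Subgroup G) := by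
  choose g hg hg' using hS
  refine Nat.card_le_card_of_injective (fun c : S => (⟨g c c.2, ?_, hg _ _⟩ :
    (expSubgroup ρ T hT ⊓ K : Subgroup G))) fun c d hcd => ?_
  · change ρ _ - 1 ∈ T
    rw [hg']; exact hST c.2
  · have h1 := congrArg (fun x : (expSubgroup ρ T hT ⊓ K : Subgroup G) => ρ x - 1) hcd
    simp only [hg'] at h1
    exact Subtype.ext h1

/-- The logarithms of the conjugates by `b` and `b⁻¹` differ only in the sign of the ring
commutator; their difference and sum isolate twice each term, and 2 is invertible. -/
theorem sub_and_mul_mem_of_conj_mem {h : ℕ} (hR : ∀ y : R, (2 * h + 1) • y = 0) {E : Subgroup G}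
    (hE : IsQuadraticOn ρ E) {b : G} (hb : (ρ b - 1) * (ρ b - 1) = 0) {e : G} (he : e ∈ E)
    (h1 : b * e * b⁻¹ ∈ E) (h2 : b⁻¹ * e * b ∈ E) :
    (ρ b - 1) * (ρ e - 1) - (ρ e - 1) * (ρ b - 1) ∈ hE.log ∧
      (ρ b - 1) * (ρ e - 1) * (ρ b - 1) ∈ hE.log := by
  have hhalf : ∀ x : R, x + x ∈ hE.log → x ∈ hE.log := by
    intro x hx
    have h0 : x = -(h • (x + x)) := by
      rw [eq_neg_iff_add_eq_zero, smul_add, ← add_nsmul, ← two_mul, add_comm, ← succ_nsmul]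
      exact hR x
    rw [h0]
    exact hE.log.neg_mem (hE.log.nsmul_mem hx h)
  have m0 : ρ e - 1 ∈ hE.log := ⟨e, he, rfl⟩
  have m1 : ρ (b * e * b⁻¹) - 1 ∈ hE.log := ⟨_, h1, rfl⟩
  have m2 : ρ (b⁻¹ * e * b) - 1 ∈ hE.log := ⟨_, h2, rfl⟩
  rw [map_conj_sub_one hb] at m1
  rw [map_conj_inv_sub_one hb] at m2
  constructor
  · refine hhalf _ ?_
    convert hE.log.sub_mem m1 m2 using 1
    abel
  · refine hhalf _ ?_
    convert hE.log.sub_mem (hE.log.sub_mem (hE.log.add_mem m0 m0) m1) m2 using 1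
    abel

/-- Replacement by a limit: if a quadratic subgroup `E` is not normalized by `b`, although the
conjugates of `E` by powers of `b` normalize each other, then the limit of these conjugates
intersects the terms of the lower central series in larger subgroups. -/
theorem exists_replacement [Finite R] [Finite G] [Group.IsNilpotent G]
    (hρ : Function.Injective ρ) {h : ℕ} (hR : ∀ y : R, (2 * h + 1) • y = 0)
    {E : Subgroup G} (hE : IsQuadraticOn ρ E) {b : G} (hb : (ρ b - 1) * (ρ b - 1) = 0)
    (hN : ∀ k ∈ Subgroup.zpowers b, ∀ e ∈ E, ∀ f ∈ E, k * e * k⁻¹ * f * (k * e * k⁻¹)⁻¹ ∈ E)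
    (hbE : ∃ e ∈ E, b * e * b⁻¹ ∉ E) :
    ∃ F : Subgroup G, IsQuadraticOn ρ F ∧
      (∀ g ∈ F, ρ g - 1 ∈ limitSubgroup (X + C (ρ b - 1)) (X - C (ρ b - 1)) hE.log) ∧
      (∀ n, Nat.card (E ⊓ (⊤ : Subgroup G).lowerCentralSeries n : Subgroup G) ≤
        Nat.card (F ⊓ (⊤ : Subgroup G).lowerCentralSeries n : Subgroup G)) ∧
      ∃ n, Nat.card (E ⊓ (⊤ : Subgroup G).lowerCentralSeries n : Subgroup G) <
        Nat.card (F ⊓ (⊤ : Subgroup G).lowerCentralSeries n : Subgroup G) := by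
  set β := ρ b - 1 with hβ
  set γ : ℕ → Subgroup G := (⊤ : Subgroup G).lowerCentralSeries with hγ
  have hγn : ∀ n, (γ n).Normal := fun n => inferInstance
  have hγc : ∀ n, ∀ e ∈ γ n, ∀ x, ⁅e, x⁆ ∈ γ (n + 1) := fun n e he x =>
    Subgroup.commutator_mem_commutator he (Subgroup.mem_top x)
  obtain ⟨pq, -⟩ := X_sub_C_mul_X_add_C_of_sq_zero hb
  have hT : ∀ x ∈ limitSubgroup (X + C β) (X - C β) hE.log,
      ∀ y ∈ limitSubgroup (X + C β) (X - C β) hE.log, x * y = 0 := fun x hx y hy =>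
    mul_eq_zero_of_mem_limitSubgroup pq (by
      rintro _ ⟨e, he, rfl⟩ _ ⟨f, hf, rfl⟩; exact hE e he f hf) hx hy
  have hEi : ∀ n, IsQuadraticOn ρ (E ⊓ γ n) := fun n => hE.mono inf_le_left
  have hle : ∀ n, (hEi n).log ≤ hE.log := by
    rintro n _ ⟨e, he, rfl⟩
    exact ⟨e, he.1, rfl⟩
  refine ⟨expSubgroup ρ _ hT, fun e he f hf => hT _ he _ hf, fun g hg => hg, ?_, ?_⟩
  · intro n
    have hm := limitSubgroup_mono (X + C β) (X - C β) (hle n)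
    rw [← (hEi n).card_log hρ]
    refine (card_le_card_limitSubgroup (monic_X_add_C β) (monic_X_sub_C β)
      (natDegree_add_C.trans_le natDegree_X_le) (natDegree_X_sub_C_le β) _).trans
      (card_le_card_expSubgroup_inf hm fun c hc => ?_)
    obtain ⟨_, ⟨e₀, h₀, rfl⟩, _, ⟨e₁, h₁, rfl⟩, _, ⟨e₂, h₂, rfl⟩, hc'⟩ :=
      exists_of_mem_limitSubgroup hc
    obtain ⟨g, hg, hK⟩ := exists_map_sub_one_eq hR hE hb hN h₀.1 h₁.1 h₂.1 hc'
      (hT _ (hm hc) _ (hm hc))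
    have hanti : γ (n + 1) ≤ γ n := Subgroup.lowerCentralSeries_antitone _ n.le_succ
    exact ⟨g, hK _ (hγn n) h₀.2 (fun x => hanti (hγc n _ h₁.2 x))
      (fun x => hanti (hγc n _ h₂.2 x)), hg⟩
  -- The last term of the series in which `b` moves some element of `E` out of `E`. The strict
  -- increase is found at `n + 1`, where `E ⊓ γ (n + 1)` is normalized by `b` and hence contained in
  -- the new group.
  · obtain ⟨n, hn, hn'⟩ : ∃ n, (∃ e ∈ E ⊓ γ n, b * e * b⁻¹ ∉ E) ∧
        ∀ e ∈ E ⊓ γ (n + 1), b * e * b⁻¹ ∈ E := by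
      by_contra! hcon
      have : ∀ n, ∃ e ∈ E ⊓ γ n, b * e * b⁻¹ ∉ E := by
        intro n
        induction n with
        | zero =>
          obtain ⟨e, he, hbe⟩ := hbE
          exact ⟨e, ⟨he, Subgroup.mem_top e⟩, hbe⟩
        | succ n ih => exact hcon n ih
      obtain ⟨m, hm⟩ := Subgroup.nilpotent_iff_lowerCentralSeries.1 ‹Group.IsNilpotent G›
      obtain ⟨e, he, hbe⟩ := this m
      have : e = 1 := by
        have : e ∈ γ m := he.2
        rwa [hγ, hm, Subgroup.mem_bot] at this
      exact hbe (by simp [this, E.one_mem])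
    obtain ⟨e, he, hbe⟩ := hn
    have hinv : ∀ f ∈ E ⊓ γ (n + 1), b * f * b⁻¹ ∈ E ⊓ γ (n + 1) := fun f hf =>
      ⟨hn' f hf, (hγn _).conj_mem _ hf.2 b⟩
    have hinv' : ∀ f ∈ E ⊓ γ (n + 1), b⁻¹ * f * b ∈ E ⊓ γ (n + 1) := by
      have hpow : ∀ k : ℕ, ∀ f ∈ E ⊓ γ (n + 1), b ^ k * f * (b ^ k)⁻¹ ∈ E ⊓ γ (n + 1) := by
        intro k
        induction k with
        | zero => simp
        | succ k ih =>
          intro f hf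
          have := ih _ (hinv f hf)
          rw [pow_succ, mul_inv_rev]
          simpa only [mul_assoc] using this
      -- In a finite group `b⁻¹` is a positive power of `b`, so invariance under `b` gives
      -- invariance under `b⁻¹`.
      obtain ⟨k, hk⟩ : ∃ k : ℕ, b ^ k = b⁻¹ := by
        have : b⁻¹ ∈ Submonoid.powers b := by
          rw [mem_powers_iff_mem_zpowers]; exact inv_mem (Subgroup.mem_zpowers b)
        exact this
      intro f hf
      have := hpow k f hf
      rwa [hk, inv_inv] at this
    have hpoly : ∀ f ∈ E ⊓ γ (n + 1), ∃ y : R[X], (∀ i, y.coeff i ∈ hE.log) ∧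
        (X + C β) * y * (X - C β) = X ^ 4 * C (ρ f - 1) := by
      intro f hf
      obtain ⟨h1, h2⟩ := sub_and_mul_mem_of_conj_mem hR (hEi (n + 1)) hb hf (hinv f hf)
        (hinv' f hf)
      exact exists_polynomial_of_invariant hb ⟨f, hf.1, rfl⟩ (hle _ h1) (hle _ h2)
    have hsub : E ⊓ γ (n + 1) ≤ expSubgroup ρ _ hT ⊓ γ (n + 1) := by
      intro f hf
      obtain ⟨y, hy, hy'⟩ := hpoly f hf
      exact ⟨⟨y, hy, 4, _, hy', by simp⟩, hf.2⟩
    suffices ∃ g ∈ expSubgroup ρ _ hT ⊓ γ (n + 1), g ∉ E by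
      obtain ⟨g, hg, hgE⟩ := this
      refine ⟨n + 1, ?_⟩
      exact Set.ncard_lt_ncard ((Set.ssubset_iff_of_subset
        (s := ((E ⊓ γ (n + 1) : Subgroup G) : Set G))
        (t := ((expSubgroup ρ _ hT ⊓ γ (n + 1) : Subgroup G) : Set G)) hsub).2
          ⟨g, hg, fun hg' => hgE hg'.1⟩) (Set.toFinite _)
    set a := ρ e - 1 with ha
    have haE : a ∈ hE.log := ⟨e, he.1, rfl⟩
    have hCa : ∀ i, (C a : R[X]).coeff i ∈ hE.log := by
      intro i
      rw [coeff_C]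
      split_ifs
      exacts [haE, hE.log.zero_mem]
    have hΨ := X_add_C_mul_C_mul_X_sub_C β a
    -- The constant polynomial `C a` has this lowest term; by centrality of `γ n` modulo `γ (n +
    -- 1)`, the corresponding group element lies one step further down the series.
    have hmem : -(β * a * β) ∈ limitSubgroup (X + C β) (X - C β) hE.log :=
      ⟨C a, hCa, 0, X ^ 2 * C a + X * C (β * a - a * β) - C (β * a * β),
        by rw [hΨ, pow_zero, one_mul], by simp [sq, mul_assoc]⟩
    obtain ⟨g, hg, hK⟩ := exists_map_sub_one_eq hR hE hb hN E.one_mem E.one_mem he.1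
      (c := -(β * a * β)) (by simp [← hβ, ← ha]) (hT _ hmem _ hmem)
    have hgγ : g ∈ γ (n + 1) := hK _ (hγn _) (one_mem _) (fun x => by simp) (hγc n e he.2)
    -- If `g` lies in `E`, its polynomial `y` cancels the lowest term of `X ^ 4 * C a`, and the next
    -- term `β * a - a * β` becomes a limit. Its group element `k` cannot lie in `E` as well, since
    -- `b * e * b⁻¹ = e * k * g`.
    by_cases hgE : g ∈ E
    · obtain ⟨y, hy, hy'⟩ := hpoly g ⟨hgE, hgγ⟩
      have hmem' : β * a - a * β ∈ limitSubgroup (X + C β) (X - C β) hE.log := by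
        refine ⟨X ^ 4 * C a - y, fun i => ?_, 5, X * C a + C (β * a - a * β), ?_, by simp⟩
        · rw [coeff_sub, coeff_X_pow_mul']
          refine hE.log.sub_mem ?_ (hy i)
          split_ifs
          exacts [hCa _, hE.log.zero_mem]
        · rw [mul_sub (X + C β), sub_mul _ _ (X - C β), hy', hg, ← mul_assoc, ← X_pow_mul, mul_assoc, mul_assoc,
            ← mul_assoc (X + C β), hΨ, C_neg]
          noncomm_ring
      obtain ⟨k, hk, hK'⟩ := exists_map_sub_one_eq hR hE hb hN E.one_mem he.1 E.one_mem
        (c := β * a - a * β) (by simp [← hβ, ← ha]) (hT _ hmem' _ hmem')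
      refine ⟨k, ⟨?_, hK' _ (hγn _) (one_mem _) (hγc n e he.2) (fun x => by simp)⟩, fun hkE => ?_⟩
      · exact mem_expSubgroup.2 (hk ▸ hmem')
      · refine hbe ?_
        have : ρ (b * e * b⁻¹) - 1 = ρ (e * k * g) - 1 := by
          rw [map_conj_sub_one hb, hE.map_mul_sub_one (E.mul_mem he.1 hkE) hgE,
            hE.map_mul_sub_one he.1 hkE, hk, hg, ← sub_eq_add_neg]
        rw [hρ (sub_left_injective this)]
        exact E.mul_mem (E.mul_mem he.1 hkE) hgE
    · refine ⟨g, ⟨?_, hgγ⟩, hgE⟩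
      exact mem_expSubgroup.2 (hg ▸ hmem)

end Representation

/-! ### Fixed points do not shrink in the limit. -/

section FixedPoints

variable {k M : Type*} [Field k] [AddCommGroup M] [Module k M]

/-- The common kernel of the endomorphisms in `S`. -/
def commonKernel (S : AddSubgroup (Module.End k M)) : Submodule k M where
  carrier := {m | ∀ c ∈ S, c m = 0}
  zero_mem' := by simp
  add_mem' := fun {a b} ha hb c hc => by simp [ha c hc, hb c hc]
  smul_mem' := fun t m hm c hc => by simp [hm c hc]

/-- The endomorphisms annihilated on the left by `S`. -/
def rightAnnihilator (S : AddSubgroup (Module.End k M)) : AddSubgroup (Module.End k M) where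
  carrier := {r | ∀ c ∈ S, c * r = 0}
  zero_mem' := by simp
  add_mem' := fun {a b} ha hb c hc => by simp [mul_add, ha c hc, hb c hc]
  neg_mem' := fun {a} ha c hc => by simp [ha c hc]

/-- An endomorphism killed by `S` on the left is a linear map into the common kernel. This expresses
the size of the kernel by an additive subgroup of the ring, to which limits apply. -/
theorem card_rightAnnihilator [Finite k] [Finite M] (S : AddSubgroup (Module.End k M)) :
    Nat.card (rightAnnihilator S) = Nat.card (commonKernel S) ^ Module.finrank k M := by
  have e : rightAnnihilator S ≃ (M →ₗ[k] commonKernel S) :=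
    { toFun := fun r => r.1.codRestrict _ fun m c hc => LinearMap.congr_fun (r.2 c hc) m
      invFun := fun f => ⟨(commonKernel S).subtype ∘ₗ f, fun c hc => LinearMap.ext fun m =>
        (f m).2 c hc⟩
      left_inv := fun r => rfl
      right_inv := fun f => rfl }
  rw [Nat.card_congr e, Module.natCard_eq_pow_finrank (K := k),
    Module.natCard_eq_pow_finrank (K := k) (V := commonKernel S), Module.finrank_linearMap,
    ← pow_mul, mul_comm]

/-- The limit of the right annihilator of `S` under left multiplication by `X + C β` is at least as
large and annihilates the limit of `S`, because `(X - C β) * (X + C β) = X ^ 2`. Comparing orders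
gives the claim after extracting a root of degree `finrank k M`, which is why `M = 0` is treated
apart. -/
theorem card_commonKernel_le [Finite k] [Finite M] {β : Module.End k M} (hβ : β * β = 0)
    (S : AddSubgroup (Module.End k M)) :
    Nat.card (commonKernel S) ≤
      Nat.card (commonKernel (limitSubgroup (X + C β) (X - C β) S)) := by
  have : Finite (Module.End k M) := Finite.of_injective _ DFunLike.coe_injective
  rcases subsingleton_or_nontrivial M with hM | hM
  · have : Nat.card (commonKernel S) = 1 := Nat.card_of_subsingleton 0
    rw [this]
    exact Nat.card_pos
  · set T := limitSubgroup (X + C β) (X - C β) S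
    have h1 := card_le_card_limitSubgroup (monic_X_add_C β) monic_one
      (natDegree_add_C.trans_le natDegree_X_le) (by simp) (rightAnnihilator S)
    have h2 : limitSubgroup (X + C β) 1 (rightAnnihilator S) ≤ rightAnnihilator T :=
      fun d hd c hc => mul_eq_zero_of_mem_limitSubgroup (S := S) (T := rightAnnihilator S)
        (X_sub_C_mul_X_add_C_of_sq_zero hβ).1 (fun x hx y hy => hy x hx) hc hd
    have h3 := h1.trans (AddSubgroup.card_le_of_le h2)
    rw [card_rightAnnihilator, card_rightAnnihilator] at h3
    exact (Nat.pow_le_pow_iff_left Module.finrank_pos.ne').1 h3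

end FixedPoints

/-! ### Thompson's replacement: minimal offenders are quadratic. -/

section Action

variable {G V : Type*} [Group G] [CommGroup V] [MulDistribMulAction G V]

/-- For an action of a finite `p`-group on a finite `p`-group, no nontrivial subgroup `W` satisfies
`W ≤ [W, E]`. -/
theorem eq_bot_of_le_actionCommutator {p : ℕ} [Fact p.Prime] [Finite G] [Finite V]
    (hG : IsPGroup p G) (hV : IsPGroup p V) {E : Subgroup G} {W : Subgroup V}
    (hW : W ≤ actionCommutator W E) : W = ⊥ := by
  let S := V ⋊[MulDistribMulAction.toMulAut G V] G
  have hfin : Finite S := Finite.of_equiv _ SemidirectProduct.equivProd.symm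
  have hS : IsPGroup p S := by
    obtain ⟨m, hm⟩ := IsPGroup.iff_card.1 hG
    obtain ⟨n, hn⟩ := IsPGroup.iff_card.1 hV
    refine IsPGroup.of_card (n := n + m) ?_
    rw [SemidirectProduct.card, hm, hn, pow_add]
  have := hS.isNilpotent
  obtain ⟨n, hn⟩ := Subgroup.nilpotent_iff_lowerCentralSeries.1 this
  have key : ∀ n, W ≤ ((⊤ : Subgroup S).lowerCentralSeries n).comap SemidirectProduct.inl := by
    intro n
    induction n with
    | zero => exact fun w _ => Subgroup.mem_top _
    | succ n ih =>
      refine hW.trans ((Subgroup.closure_le _).2 ?_)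
      rintro _ ⟨e, -, w, hw, rfl⟩
      have h1 : (SemidirectProduct.inl ((e • w) * w⁻¹) : S) =
          ⁅(SemidirectProduct.inr e : S), (SemidirectProduct.inl w : S)⁆ := by
        rw [commutatorElement_def, map_mul, map_inv, ← map_inv SemidirectProduct.inr,
          ← SemidirectProduct.inl_aut]
        rfl
      refine Subgroup.mem_comap.2 ?_
      rw [h1, ← inv_mem_iff, commutatorElement_inv]
      exact Subgroup.commutator_mem_commutator (ih hw) (Subgroup.mem_top _)
  rw [eq_bot_iff]
  intro w hw
  have := key n hw
  rw [hn] at this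
  exact SemidirectProduct.inl_injective (this : (SemidirectProduct.inl w : S) = 1)

/-- The commutator subgroup `[x, E]` for an element `x`. -/
def elementCommutator (x : V) (E : Subgroup G) : Subgroup V :=
  Subgroup.closure {y | ∃ e ∈ E, y = (e • x) * x⁻¹}

/-- The elements of `E` which centralize `W`. -/
def pointwiseCentralizer (E : Subgroup G) (W : Subgroup V) : Subgroup G where
  carrier := {a | a ∈ E ∧ ∀ w ∈ W, a • w = w}
  one_mem' := ⟨E.one_mem, fun w _ => one_smul G w⟩
  mul_mem' := fun {a b} ha hb => ⟨E.mul_mem ha.1 hb.1, fun w hw => by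
    rw [mul_smul, hb.2 w hw, ha.2 w hw]⟩
  inv_mem' := fun {a} ha => ⟨E.inv_mem ha.1, fun w hw => by
    rw [inv_smul_eq_iff, ha.2 w hw]⟩

/-- Thompson's counting argument: passing from an abelian group `E` to the centralizer of `[x, E]`
does not decrease `|E| |C_V(E)|`. -/
theorem card_mul_card_fixedPoints_le [Finite G] [Finite V] {E : Subgroup G}
    (hE : ∀ a ∈ E, ∀ b ∈ E, a * b = b * a) (x : V) :
    Nat.card E * Nat.card (FixedPoints.subgroup E V) ≤
      Nat.card (pointwiseCentralizer E (elementCommutator x E)) *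
        Nat.card (elementCommutator x E ⊔ FixedPoints.subgroup E V : Subgroup V) := by
  set W := elementCommutator x E
  set D := FixedPoints.subgroup E V
  set B := pointwiseCentralizer E W
  have hBE : B ≤ E := fun a ha => ha.1
  have hmem : ∀ a ∈ E, (a • x) * x⁻¹ ∈ W := fun a ha => Subgroup.subset_closure ⟨a, ha, rfl⟩
  have hD : ∀ c ∈ D, ∀ d ∈ E, d • c = c := fun c hc d hd => hc ⟨d, hd⟩
  -- If `a • x` and `b • x` agree modulo `C_V(E)`, then `a` and `b` act alike on `[x, E]`, because
  -- `E` is abelian and so `a` sends `[d, x]` to `[d, a • x]`. Thus cosets of `B` give distinct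
  -- cosets of `D` in `W ⊔ D`.
  have key : ∀ a ∈ E, ∀ b ∈ E, ∀ c ∈ D, ∀ c' ∈ D, (a • x) * x⁻¹ * c = (b • x) * x⁻¹ * c' →
      a⁻¹ * b ∈ B := by
    intro a ha b hb c hc c' hc' h
    refine ⟨E.mul_mem (E.inv_mem ha) hb, fun w hw => ?_⟩
    rw [mul_smul, inv_smul_eq_iff]
    have hx : a • x = (b • x) * (c' * c⁻¹) := by
      refine mul_right_cancel (b := x⁻¹ * c) ?_
      rw [← mul_assoc, h, mul_assoc, mul_assoc, mul_comm x⁻¹ c, mul_assoc c',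
        inv_mul_cancel_left, mul_comm c']
    induction hw using Subgroup.closure_induction with
    | mem w hw =>
      obtain ⟨d, hd, rfl⟩ := hw
      have h1 : ∀ g ∈ E, g • ((d • x) * x⁻¹) = (d • (g • x)) * (g • x)⁻¹ := by
        intro g hg
        rw [smul_mul', smul_inv', ← mul_smul, hE g hg d hd, mul_smul]
      rw [h1 a ha, h1 b hb, hx, smul_mul', hD _ (D.mul_mem hc' (D.inv_mem hc)) d hd, mul_inv,
        mul_mul_mul_comm, mul_inv_cancel, mul_one]
    | one => simp
    | mul u v _ _ hu hv => rw [smul_mul', smul_mul', hu, hv]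
    | inv u _ hu => rw [smul_inv', smul_inv', hu]
  have hcardB : Nat.card (B.subgroupOf E) = Nat.card B :=
    Nat.card_congr (Subgroup.subgroupOfEquivOfLe hBE).toEquiv
  rw [Nat.card_congr (Subgroup.groupEquivQuotientProdSubgroup (s := B.subgroupOf E)),
    Nat.card_prod, hcardB, mul_comm _ (Nat.card B), mul_assoc]
  refine Nat.mul_le_mul_left _ ?_
  rw [← Nat.card_prod]
  refine Nat.card_le_card_of_injective
    (fun q : (E ⧸ B.subgroupOf E) × D => (⟨(q.1.out • x) * x⁻¹ * q.2,
      Subgroup.mul_mem_sup (hmem _ q.1.out.2) q.2.2⟩ : (W ⊔ D : Subgroup V))) ?_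
  rintro ⟨s, c⟩ ⟨t, d⟩ h
  have h' : (s.out • x) * x⁻¹ * (c : V) = (t.out • x) * x⁻¹ * d := congrArg Subtype.val h
  have hst : s = t := by
    rw [← QuotientGroup.out_eq' s, ← QuotientGroup.out_eq' t, QuotientGroup.eq,
      Subgroup.mem_subgroupOf]
    exact key _ s.out.2 _ t.out.2 _ c.2 _ d.2 h'
  subst hst
  exact Prod.ext rfl (Subtype.ext (mul_left_cancel h'))

/-- A minimal offender in a `p`-group acts quadratically. -/
theorem smul_commutator_eq_of_minimal {p : ℕ} [Fact p.Prime] [Finite G] [Finite V]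
    (hG : IsPGroup p G) (hV : IsPGroup p V) {E : Subgroup G} (hE : IsOffender V p E)
    (hmin : ∀ F : Subgroup G, IsOffender V p F → Nat.card E ≤ Nat.card F) (x : V) :
    ∀ a ∈ E, ∀ d ∈ E, a • ((d • x) * x⁻¹) = (d • x) * x⁻¹ := by
  obtain ⟨hne, hel, hcard⟩ := hE
  have hab : ∀ a ∈ E, ∀ b ∈ E, a * b = b * a := fun a ha b hb =>
    congrArg Subtype.val (hel.1 ⟨a, ha⟩ ⟨b, hb⟩)
  have hle := card_mul_card_fixedPoints_le hab x
  set W := elementCommutator x E with hW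
  set D := FixedPoints.subgroup E V
  set B := pointwiseCentralizer E W
  have hBE : B ≤ E := fun a ha => ha.1
  suffices E ≤ B from fun a ha d hd => (this ha).2 _ (Subgroup.subset_closure ⟨d, hd, rfl⟩)
  by_cases hB : B = ⊥
  · rw [hB, Subgroup.card_bot, one_mul] at hle
    -- With `B` trivial the counting forces `V` to be the product of `W` and `C_V(E)`, whence `W =
    -- [x, E] ≤ [W, E]`, and nilpotency gives `W = 1`.
    have htop : W ⊔ D = ⊤ := Subgroup.eq_top_of_le_card _ (hcard.trans hle)
    have hbot : W = ⊥ := by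
      refine eq_bot_of_le_actionCommutator hG hV (E := E) ((Subgroup.closure_le _).2 ?_)
      rintro _ ⟨e, he, rfl⟩
      obtain ⟨w, hw, c, hc, rfl⟩ := Subgroup.mem_sup.1 (htop ▸ Subgroup.mem_top x)
      refine Subgroup.subset_closure ⟨e, he, w, hw, ?_⟩
      have : e • c = c := hc ⟨e, he⟩
      rw [smul_mul', this, mul_inv, mul_mul_mul_comm, mul_inv_cancel, mul_one]
    refine fun a ha => ⟨ha, fun w hw => ?_⟩
    rw [hbot, Subgroup.mem_bot] at hw
    rw [hw, smul_one]
  · have hWD : W ⊔ D ≤ FixedPoints.subgroup B V :=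
      sup_le (fun w hw b => b.2.2 w hw) fun c hc b => hc ⟨b, hBE b.2⟩
    have hoff : IsOffender V p B :=
      ⟨hB, ⟨fun a b => Subtype.ext (hab _ (hBE a.2) _ (hBE b.2)), fun a => Subtype.ext (by
        simpa using congrArg Subtype.val (hel.2 ⟨a, hBE a.2⟩))⟩,
        (hcard.trans hle).trans (Nat.mul_le_mul_left _ (Subgroup.card_le_of_le hWD))⟩
    exact (Subgroup.eq_of_le_of_card_ge hBE (hmin B hoff)).ge

end Action

/-! ### Translation to linear representations, and the extremal choice of `E`. -/

section Action

variable {G V : Type*} [Group G] [CommGroup V] [MulDistribMulAction G V]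

variable (G V) in
/-- The linear representation over `ZMod p` given by an action on an elementary abelian
`p`-group. -/
def linearRepresentation (p : ℕ) [Module (ZMod p) (Additive V)] :
    G →* Module.End (ZMod p) (Additive V) where
  toFun g := AddMonoidHom.toZModLinearMap p
    (MonoidHom.toAdditive (MulDistribMulAction.toMonoidHom V g))
  map_one' := LinearMap.ext fun v => congrArg Additive.ofMul (one_smul G v.toMul)
  map_mul' a b := LinearMap.ext fun v => congrArg Additive.ofMul (mul_smul a b v.toMul)

variable {p : ℕ} [Module (ZMod p) (Additive V)]

theorem linearRepresentation_apply (g : G) (v : Additive V) :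
    linearRepresentation G V p g v = Additive.ofMul (g • v.toMul) := rfl

theorem linearRepresentation_sub_one_apply (g : G) (v : Additive V) :
    (linearRepresentation G V p g - 1) v = Additive.ofMul ((g • v.toMul) * v.toMul⁻¹) := by
  rw [LinearMap.sub_apply, linearRepresentation_apply, Module.End.one_apply, sub_eq_add_neg]
  rfl

theorem linearRepresentation_injective [FaithfulSMul G V] :
    Function.Injective (linearRepresentation G V p) := fun _ _ h =>
  eq_of_smul_eq_smul fun v : V => congrArg Additive.toMul
    (LinearMap.congr_fun h (Additive.ofMul v))

theorem isQuadraticOn_iff {E : Subgroup G} : IsQuadraticOn (linearRepresentation G V p) E ↔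
    ∀ x : V, ∀ a ∈ E, ∀ d ∈ E, a • ((d • x) * x⁻¹) = (d • x) * x⁻¹ := by
  constructor
  · intro h x a ha d hd
    have := LinearMap.congr_fun (h a ha d hd) (Additive.ofMul x)
    rw [Module.End.mul_apply, linearRepresentation_sub_one_apply,
      linearRepresentation_sub_one_apply] at this
    exact mul_inv_eq_one.1 (congrArg Additive.toMul this)
  · intro h a ha d hd
    refine LinearMap.ext fun x => ?_
    rw [Module.End.mul_apply, linearRepresentation_sub_one_apply,
      linearRepresentation_sub_one_apply]
    exact congrArg Additive.ofMul (mul_inv_eq_one.2 (h x.toMul a ha d hd))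

theorem IsQuadraticOn.actsQuadratically [FaithfulSMul G V] {E : Subgroup G}
    (h : IsQuadraticOn (linearRepresentation G V p) E) (hE : E ≠ ⊥) : ActsQuadratically V E := by
  rw [isQuadraticOn_iff] at h
  constructor
  · rw [eq_bot_iff]
    refine (Subgroup.closure_le _).2 ?_
    rintro _ ⟨a, ha, w, hw, rfl⟩
    change (a • w) * w⁻¹ = 1
    rw [mul_inv_eq_one]
    induction hw using Subgroup.closure_induction with
    | mem w hw => obtain ⟨d, hd, x, -, rfl⟩ := hw; exact h x a ha d hd
    | one => simp
    | mul u v _ _ hu hv => rw [smul_mul', hu, hv]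
    | inv u _ hu => rw [smul_inv', hu]
  · intro hbot
    refine hE ((Subgroup.eq_bot_iff_forall _).2 fun e he => eq_of_smul_eq_smul fun v : V => ?_)
    have : (e • v) * v⁻¹ ∈ actionCommutator (⊤ : Subgroup V) E :=
      Subgroup.subset_closure ⟨e, he, v, Subgroup.mem_top v, rfl⟩
    rw [hbot, Subgroup.mem_bot, mul_inv_eq_one] at this
    rw [this, one_smul]

theorem IsQuadraticOn.isElementaryAbelianP [FaithfulSMul G V] {E : Subgroup G}
    (h : IsQuadraticOn (linearRepresentation G V p) E) : IsElementaryAbelianP p E := by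
  have hinj := linearRepresentation_injective (G := G) (V := V) (p := p)
  refine ⟨fun a b => Subtype.ext (hinj (sub_left_injective (b := 1) ?_)),
    fun a => Subtype.ext (hinj (sub_left_injective (b := 1) ?_))⟩
  · change linearRepresentation G V p (a * b) - 1 = linearRepresentation G V p (b * a) - 1
    rw [h.map_mul_sub_one a.2 b.2, h.map_mul_sub_one b.2 a.2, add_comm]
  · change linearRepresentation G V p ((a : G) ^ p) - 1 = linearRepresentation G V p 1 - 1
    rw [h.map_pow_sub_one a.2, map_one, sub_self]
    rw [← Nat.cast_smul_eq_nsmul (ZMod p)]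
    simp

theorem card_commonKernel_log [Fact p.Prime] {E : Subgroup G}
    (h : IsQuadraticOn (linearRepresentation G V p) E) :
    Nat.card (FixedPoints.subgroup E V) = Nat.card (commonKernel h.log) := by
  refine Nat.card_congr (Equiv.subtypeEquiv Additive.ofMul fun v => ⟨?_, fun hv e => ?_⟩)
  · rintro hv _ ⟨e, he, rfl⟩
    rw [linearRepresentation_sub_one_apply]
    exact congrArg Additive.ofMul (mul_inv_eq_one.2 (hv ⟨e, he⟩))
  · have := hv _ ⟨e, e.2, rfl⟩
    rw [linearRepresentation_sub_one_apply] at this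
    exact mul_inv_eq_one.1 (congrArg Additive.toMul this)

theorem card_commonKernel_le_card_fixedPoints [Fact p.Prime] [Finite V] {F : Subgroup G}
    {T : AddSubgroup (Module.End (ZMod p) (Additive V))}
    (h : ∀ g ∈ F, linearRepresentation G V p g - 1 ∈ T) :
    Nat.card (commonKernel T) ≤ Nat.card (FixedPoints.subgroup F V) := by
  refine Nat.card_le_card_of_injective (fun v => (⟨v.1.toMul, fun g => ?_⟩ :
    FixedPoints.subgroup F V)) fun v w hvw => Subtype.ext
      (congrArg (fun z : FixedPoints.subgroup F V => Additive.ofMul (z : V)) hvw)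
  have := v.2 _ (h g g.2)
  rw [linearRepresentation_sub_one_apply] at this
  exact mul_inv_eq_one.1 (congrArg Additive.toMul this)

/-- A quadratic offender whose intersections with the terms of the lower central series are as
large as possible is normalized by every conjugate `b` of an element of it for which the conjugates
under powers of `b` normalize each other. -/
theorem exists_maximal_quadratic_offender [Fact p.Prime] (hp2 : p ≠ 2) [Finite G] [Finite V]
    (hG : IsPGroup p G) [FaithfulSMul G V]
    (hE : ∃ E : Subgroup G, IsOffender V p E ∧ IsQuadraticOn (linearRepresentation G V p) E) :
    ∃ E : Subgroup G, IsOffender V p E ∧ IsQuadraticOn (linearRepresentation G V p) E ∧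
      ∀ h : G, ∀ e ∈ E,
        (∀ k ∈ Subgroup.zpowers (h * e * h⁻¹), ∀ e ∈ E, ∀ f ∈ E,
          k * e * k⁻¹ * f * (k * e * k⁻¹)⁻¹ ∈ E) →
        ∀ f ∈ E, h * e * h⁻¹ * f * (h * e * h⁻¹)⁻¹ ∈ E := by
  have := hG.isNilpotent
  obtain ⟨N, hN⟩ := Subgroup.nilpotent_iff_lowerCentralSeries.1 this
  set γ : ℕ → Subgroup G := (⊤ : Subgroup G).lowerCentralSeries with hγ
  have hinj := linearRepresentation_injective (G := G) (V := V) (p := p)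
  have : Finite (Module.End (ZMod p) (Additive V)) := Finite.of_injective _ DFunLike.coe_injective
  have hR : ∀ y : Module.End (ZMod p) (Additive V), (2 * (p / 2) + 1) • y = 0 := by
    intro y
    rw [Nat.two_mul_div_two_add_one_of_odd ((Fact.out : p.Prime).odd_of_ne_two hp2),
      ← Nat.cast_smul_eq_nsmul (ZMod p)]
    simp
  obtain ⟨E, ⟨hoff, hquad⟩, hmax⟩ := Set.exists_max_image
    {E : Subgroup G | IsOffender V p E ∧ IsQuadraticOn (linearRepresentation G V p) E}
    (fun E => ∑ n ∈ Finset.range N, Nat.card (E ⊓ γ n : Subgroup G)) (Set.toFinite _) hE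
  refine ⟨E, hoff, hquad, fun h e he hk => ?_⟩
  set b := h * e * h⁻¹ with hb
  by_contra! hcon
  have hbb : (linearRepresentation G V p b - 1) * (linearRepresentation G V p b - 1) = 0 := by
    have hmem : b ∈ E.map (MulAut.conj h).toMonoidHom := ⟨e, he, rfl⟩
    exact hquad.conj h b hmem b hmem
  obtain ⟨F, hF, hFT, hle, n, hlt⟩ := exists_replacement hinj hR hquad hbb hk hcon
  -- The zeroth term of the lower central series is the whole group.
  have hEF : Nat.card E ≤ Nat.card F := by
    have := hle 0
    rwa [Subgroup.lowerCentralSeries_zero, inf_top_eq, inf_top_eq] at this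
  have hFne : F ≠ ⊥ := by
    rintro rfl
    have h1 := (Subgroup.one_lt_card_iff_ne_bot E).2 hoff.1
    rw [Subgroup.card_bot] at hEF
    omega
  have hFoff : IsOffender V p F := by
    refine ⟨hFne, hF.isElementaryAbelianP, hoff.2.2.trans (Nat.mul_le_mul hEF ?_)⟩
    rw [card_commonKernel_log hquad]
    exact (card_commonKernel_le hbb _).trans (card_commonKernel_le_card_fixedPoints hFT)
  -- Beyond `N` the series is trivial, so the strict inequality occurs inside the range of the
  -- maximized sum.
  have hn : n < N := by
    by_contra! hNn
    have : γ n = ⊥ := by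
      rw [eq_bot_iff, ← hN]
      exact Subgroup.lowerCentralSeries_antitone _ hNn
    change Nat.card (E ⊓ γ n : Subgroup G) < Nat.card (F ⊓ γ n : Subgroup G) at hlt
    rw [this, inf_bot_eq, inf_bot_eq] at hlt
    exact lt_irrefl _ hlt
  exact (hmax F ⟨hFoff, hF⟩).not_gt
    (Finset.sum_lt_sum (fun i _ => hle i) ⟨n, Finset.mem_range.2 hn, hlt⟩)

end Action

/-! ### Induction over overgroups of `E` and the conclusion. -/

/-- A proper subgroup `E` of a subgroup `H` of a finite nilpotent group lies in a proper normal
subgroup of `H`. -/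
theorem exists_lt_of_isNilpotent {G : Type*} [Group G] [Finite G] [Group.IsNilpotent G]
    {E H : Subgroup G} (hEH : E < H) :
    ∃ K : Subgroup G, E ≤ K ∧ K < H ∧ ∀ h ∈ H, ∀ k ∈ K, h * k * h⁻¹ ∈ K := by
  obtain ⟨L, hL, hEL⟩ := (eq_top_or_exists_le_coatom (E.subgroupOf H)).resolve_left
    fun h => hEH.not_ge (Subgroup.subgroupOf_eq_top.1 h)
  have hLn : L.Normal := Subgroup.NormalizerCondition.normal_of_coatom L
    Group.normalizerCondition_of_isNilpotent hL
  refine ⟨L.map H.subtype, fun e he => ⟨⟨e, hEH.le he⟩, hEL he, rfl⟩, ?_, ?_⟩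
  · refine lt_of_le_of_ne (Subgroup.map_subtype_le L) fun h => hL.1 ?_
    rw [eq_top_iff]
    rintro ⟨x, hx⟩ -
    rw [← h] at hx
    obtain ⟨y, hy, rfl⟩ := hx
    exact hy
  · rintro h hh _ ⟨k, hk, rfl⟩
    exact ⟨_, hLn.conj_mem k hk ⟨h, hh⟩, rfl⟩

theorem mainTheorem3 (p : ℕ) (hp : p.Prime) (hp5 : 5 ≤ p)
    {G : Type*} [Group G] [Finite G] (hG : IsPGroup p G)
    {V : Type*} [CommGroup V] [Finite V] (hV : IsElementaryAbelianP p V)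
    [MulDistribMulAction G V] (hF : IsFModule G V p) :
    ∃ E : Subgroup G, IsOffender V p E ∧ ActsQuadratically V E ∧
      (E.subgroupOf (Subgroup.normalClosure (E : Set G))).Normal := by
  have : Fact p.Prime := ⟨hp⟩
  obtain ⟨hfaith, hoff⟩ := hF
  have hVp : IsPGroup p V := fun v => ⟨1, by rw [pow_one]; exact hV.2 v⟩
  let _ : Module (ZMod p) (Additive V) := AddCommGroup.zmodModule fun v => hV.2 v.toMul
  have hnil := hG.isNilpotent
  obtain ⟨E₀, hE₀, hmin⟩ := Set.exists_min_image {E : Subgroup G | IsOffender V p E}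
    (fun E => Nat.card E) (Set.toFinite _) hoff
  obtain ⟨E, hE, hquad, hbest⟩ := exists_maximal_quadratic_offender (V := V) (p := p)
    (by omega) hG ⟨E₀, hE₀, isQuadraticOn_iff.2 (smul_commutator_eq_of_minimal hG hVp hE₀ hmin)⟩
  have main : ∀ H : Subgroup G, E ≤ H → ∀ h ∈ H, ∀ e ∈ E, ∀ f ∈ E,
      h * e * h⁻¹ * f * (h * e * h⁻¹)⁻¹ ∈ E := by
    intro H
    induction H using WellFoundedLT.induction with
    | ind H ih =>
      intro hEH h hh e he f hf
      rcases hEH.eq_or_lt with rfl | hlt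
      · have := mul_mem (mul_mem hh he) (inv_mem hh)
        exact mul_mem (mul_mem this hf) (inv_mem this)
      · obtain ⟨K, hEK, hKH, hK⟩ := exists_lt_of_isNilpotent hlt
        -- The powers of `h * e * h⁻¹` lie in the normal subgroup `K` of `H`, so the induction
        -- hypothesis for `K` makes the conjugates of `E` under them normalize each other.
        refine hbest h e he (fun k hk => ih K hKH hEK k ?_) f hf
        exact (Subgroup.zpowers_le.2 (hK h hh e (hEK he))) hk
  refine ⟨E, hE, hquad.actsQuadratically hE.1, ?_⟩
  rw [Subgroup.normal_subgroupOf_iff_le_normalizer Subgroup.le_normalClosure]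
  refine (Subgroup.closure_le _).2 fun g hg => ?_
  obtain ⟨e, he, hg⟩ := Group.mem_conjugatesOfSet_iff.1 hg
  obtain ⟨h, rfl⟩ := isConj_iff.1 hg
  refine Subgroup.mem_normalizer_iff.2 fun f => ⟨main ⊤ le_top h (Subgroup.mem_top h) e he f,
    fun hf => ?_⟩
  -- Applying `main` to `e⁻¹` undoes the conjugation by `h * e * h⁻¹`.
  have := main ⊤ le_top h (Subgroup.mem_top h) e⁻¹ (inv_mem he) _ hf
  convert this using 1
  group
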